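/- \textbf{Theorem 2.} For all constants $\gamma, K, \epsilon > 0$ there is $N = N(\gamma, K, \epsilon)$ such that the following holds for every $n \ge N$. Let $G$ be a simple undirected graph with $n$ vertices and $t$ triangles, let $\Delta$ be the largest number of triangles of $G$ sharing a common edge (with $\Delta = 0$ if $G$ has no edge), and let $p \in [0,1]$. Let $G'$ be the random graph obtained by keeping each edge of $G$ independently with probability $p$, and let $T$ be the number of triangles of $G'$. Suppose that $$\frac{pt}{\Delta} \ge \log^{6+\gamma} n \quad \text{if } p^2\Delta \ge 1, \qquad\text{and}\qquad p^3 t \ge \log^{6+\gamma} n \quad \text{if } p^2\Delta < 1.$$ Then $\mathbb{E}\,T = p^3 t$ and $$\Pr\left(|T - \mathbb{E}\,T| \ge \epsilon\, \mathbb{E}\,T\right) \le n^{-K}.$$ -/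

import Mathlib

open MeasureTheory ProbabilityTheory

noncomputable section

namespace TriangleSparsify

variable {V : Type*} [Fintype V]

open Classical in
/-- The number of triangles (sets of three mutually adjacent vertices) of a finite graph. -/
def triangleCount (G : SimpleGraph V) : ℕ :=
  (G.cliqueFinset 3).card

open Classical in
/-- The number of triangles of `G` that contain both endpoints of `e`. -/
def edgeTriangleCount (G : SimpleGraph V) (e : Sym2 V) : ℕ :=
  ((G.cliqueFinset 3).filter (fun s => ∀ v ∈ e, v ∈ s)).card

open Classical in
/-- The largest number of triangles of `G` with a common edge (`0` if `G` has no edge). -/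
def maxEdgeTriangleCount (G : SimpleGraph V) : ℕ :=
  G.edgeFinset.sup (edgeTriangleCount G)

/-- The law of the random subgraph of `G` that keeps each edge of `G` independently with
probability `p`. The measure `setBernoulli G.edgeSet p` is the law of the random set of kept
edges. -/
def sparsify (G : SimpleGraph V) (p : unitInterval) : Measure (SimpleGraph V) :=
  (setBernoulli G.edgeSet p).map SimpleGraph.fromEdgeSet

/-- The expected number of triangles of the sparsified graph. -/
def meanTriangleCount (G : SimpleGraph V) (p : unitInterval) : ℝ :=
  ∫ H, (triangleCount H : ℝ) ∂(sparsify G p)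

end TriangleSparsify

end

/-!
Write `μ = p ^ 3 * t` for the mean, `L = log n` and `M = max 1 (p ^ 2 * Δ)`. The two cases of the
hypothesis together say `μ ≥ L ^ (6 + γ) * M`; only `μ ≥ L ^ 6 * M` is needed. The only features of
triangles that matter are that they are triples of edges, that two of them share at most one edge,
and that an edge lies in at most `Δ` of them (`IsTripleSystem`).

*Upper tail.* Given that a set `B` of edges is kept, the expected number of surviving triangles is
at most `μ + #B * Δ * p ^ 2 + #B ^ 2`: triangles with one edge in `B` number at most `#B * Δ`, and a
triangle with two edges in `B` is determined by them
(`IsTripleSystem.sum_pow_card_sdiff_le`). Multiplying this over the factors of a moment of order `k`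
gives `E[T ^ k] ≤ (μ + 3 * k * Δ * p ^ 2 + 9 * k ^ 2) ^ k`. For `k` a large multiple of `L` the two
correction terms are `O(L ^ 2 * M)`, hence at most `ε / 2 * μ`, and Markov's inequality bounds the
tail by `((1 + ε / 2) / (1 + ε)) ^ k`, which is as small a power of `n` as desired.

*Lower tail.* This is Janson's inequality, in the form
`P(T ≤ (1 - ε) * μ) ≤ exp (-ε ^ 2 * μ / (4 * (1 + 3 * Δ * p ^ 2)))`, proved by bounding
`E[(1 - η) ^ T]`. The triangles are added one at a time, and Harris' inequality
(`expect_mul_expect_le`) separates the earlier triangles that share an edge with the new one, on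
average at most `3 * Δ * p ^ 2` of them surviving once the new one is kept, from those that do not
(`IsTripleSystem.le_expect_indicator_mul_discount`).

Both tails are computed with finite weighted sums over the subsets of the edge set (`expect`);
`integral_sparsify` identifies these with integrals against the law of the sparsified graph.
-/

namespace TriangleSparsify

/-! ### Expectations over a random subset of a finite set -/

section Expectation

variable {ι : Type*}

open scoped Classical in
/-- The expectation of `f S`, where `S` is the random subset of the finite set `u` that contains
each element of `u` independently with probability `p`. -/
noncomputable def expect (p : ℝ) (u : Finset ι) (f : Finset ι → ℝ) : ℝ :=
  ∑ S ∈ u.powerset, p ^ S.card * (1 - p) ^ (u \ S).card * f S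

open scoped Classical in
/-- Expectation splits according to whether the element `e` is kept. -/
lemma expect_insert {p : ℝ} {u : Finset ι} {e : ι} (he : e ∉ u) (f : Finset ι → ℝ) :
    expect p (insert e u) f =
      p * expect p u (fun S ↦ f (insert e S)) + (1 - p) * expect p u f := by
  unfold expect
  rw [Finset.sum_powerset_insert he, add_comm, Finset.mul_sum, Finset.mul_sum]
  congr 1
  · refine Finset.sum_congr rfl fun S hS ↦ ?_
    rw [Finset.mem_powerset] at hS
    have h1 : e ∉ S := fun h ↦ he (hS h)
    have h2 : insert e u \ insert e S = u \ S := by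
      ext x; simp only [Finset.mem_sdiff, Finset.mem_insert]
      constructor
      · rintro ⟨h | h, h'⟩ <;> tauto
      · rintro ⟨h, h'⟩
        exact ⟨Or.inr h, by rintro (rfl | h3) <;> tauto⟩
    rw [Finset.card_insert_of_notMem h1, h2]
    ring
  · refine Finset.sum_congr rfl fun S hS ↦ ?_
    rw [Finset.mem_powerset] at hS
    have h1 : e ∉ S := fun h ↦ he (hS h)
    rw [Finset.insert_sdiff_of_notMem _ h1, Finset.card_insert_of_notMem (by simp [he])]
    ring

lemma expect_empty (p : ℝ) (f : Finset ι → ℝ) : expect p ∅ f = f ∅ := by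
  simp [expect]

lemma expect_congr {p : ℝ} {u : Finset ι} {f g : Finset ι → ℝ} (h : ∀ S ⊆ u, f S = g S) :
    expect p u f = expect p u g :=
  Finset.sum_congr rfl fun S hS ↦ by rw [h S (Finset.mem_powerset.1 hS)]

lemma expect_const (p : ℝ) (u : Finset ι) (c : ℝ) : expect p u (fun _ ↦ c) = c := by
  classical
  induction u using Finset.induction_on with
  | empty => simp [expect]
  | insert e u he ih => rw [expect_insert he, ih]; ring

lemma expect_add (p : ℝ) (u : Finset ι) (f g : Finset ι → ℝ) :
    expect p u (fun S ↦ f S + g S) = expect p u f + expect p u g := by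
  simp only [expect, mul_add, Finset.sum_add_distrib]

lemma expect_const_mul (p : ℝ) (u : Finset ι) (c : ℝ) (f : Finset ι → ℝ) :
    expect p u (fun S ↦ c * f S) = c * expect p u f := by
  simp only [expect, Finset.mul_sum]
  exact Finset.sum_congr rfl fun S _ ↦ by ring

lemma expect_sub (p : ℝ) (u : Finset ι) (f g : Finset ι → ℝ) :
    expect p u (fun S ↦ f S - g S) = expect p u f - expect p u g := by
  simp only [expect, mul_sub, Finset.sum_sub_distrib]

lemma expect_sum {τ : Type*} (p : ℝ) (u : Finset ι) (s : Finset τ) (f : τ → Finset ι → ℝ) :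
    expect p u (fun S ↦ ∑ t ∈ s, f t S) = ∑ t ∈ s, expect p u (f t) := by
  simp only [expect, Finset.mul_sum]
  exact Finset.sum_comm

lemma expect_mono {p : ℝ} (hp : p ∈ Set.Icc (0 : ℝ) 1) {u : Finset ι} {f g : Finset ι → ℝ}
    (h : ∀ S ⊆ u, f S ≤ g S) : expect p u f ≤ expect p u g :=
  Finset.sum_le_sum fun S hS ↦ mul_le_mul_of_nonneg_left (h S (Finset.mem_powerset.1 hS))
    (mul_nonneg (pow_nonneg hp.1 _) (pow_nonneg (sub_nonneg.2 hp.2) _))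

lemma expect_nonneg {p : ℝ} (hp : p ∈ Set.Icc (0 : ℝ) 1) {u : Finset ι} {f : Finset ι → ℝ}
    (h : ∀ S ⊆ u, 0 ≤ f S) : 0 ≤ expect p u f := by
  simpa [expect_const] using expect_mono hp (f := fun _ ↦ 0) h

open scoped Classical in
lemma expect_indicator_mem {p : ℝ} {u : Finset ι} {e : ι} (he : e ∈ u) (f : Finset ι → ℝ) :
    expect p u (fun S ↦ if e ∈ S then f S else 0) = p * expect p u (fun S ↦ f (insert e S)) := by
  obtain ⟨v, hv, rfl⟩ : ∃ v, e ∉ v ∧ u = insert e v :=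
    ⟨u.erase e, by simp, (Finset.insert_erase he).symm⟩
  rw [expect_insert hv, expect_insert hv]
  have h0 : expect p v (fun S ↦ if e ∈ S then f S else 0) = 0 := by
    rw [expect_congr (g := fun _ ↦ 0), expect_const]
    exact fun S hS ↦ if_neg fun h ↦ hv (hS h)
  rw [h0]
  simp only [Finset.mem_insert_self, if_true, Finset.insert_idem]
  ring

open scoped Classical in
/-- Conditioning on the event `A ⊆ S` amounts to replacing the random set `S` by `S ∪ A`. -/
lemma expect_indicator_subset {p : ℝ} {u A : Finset ι} (hA : A ⊆ u) (f : Finset ι → ℝ) :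
    expect p u (fun S ↦ if A ⊆ S then f S else 0) =
      p ^ A.card * expect p u (fun S ↦ f (S ∪ A)) := by
  induction A using Finset.induction_on generalizing f with
  | empty => simp
  | insert e A he ih =>
    rw [Finset.insert_subset_iff] at hA
    have h1 : ∀ S, (if insert e A ⊆ S then f S else 0) =
        if A ⊆ S then (if e ∈ S then f S else 0) else 0 := by
      intro S
      simp only [Finset.insert_subset_iff]
      split_ifs <;> tauto
    simp only [h1]
    rw [ih hA.2, Finset.card_insert_of_notMem he]
    have h2 : ∀ S, (if e ∈ S ∪ A then f (S ∪ A) else 0) =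
        if e ∈ S then f (S ∪ A) else 0 := by
      intro S; simp [he]
    simp only [h2]
    rw [expect_indicator_mem hA.1 (fun S ↦ f (S ∪ A)), pow_succ, mul_assoc]
    simp only [Finset.insert_union, Finset.union_insert]

open scoped Classical in
lemma expect_subset {p : ℝ} {u A : Finset ι} (hA : A ⊆ u) :
    expect p u (fun S ↦ if A ⊆ S then 1 else 0) = p ^ A.card := by
  rw [expect_indicator_subset hA (fun _ ↦ 1), expect_const, mul_one]

/-- **Harris' inequality**: decreasing functions of a random set are positively correlated. -/
lemma expect_mul_expect_le {p : ℝ} (hp : p ∈ Set.Icc (0 : ℝ) 1) (u : Finset ι)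
    {f g : Finset ι → ℝ} (hf : Antitone f) (hg : Antitone g) :
    expect p u f * expect p u g ≤ expect p u (fun S ↦ f S * g S) := by
  classical
  induction u using Finset.induction_on generalizing f g with
  | empty => simp [expect_empty]
  | insert e u he ih =>
    have hi : Monotone fun S : Finset ι ↦ insert e S :=
      fun S T h ↦ Finset.insert_subset_insert e h
    have h0 := ih hf hg
    have h1 := ih (hf.comp_monotone hi) (hg.comp_monotone hi)
    have hf' : expect p u (fun S ↦ f (insert e S)) ≤ expect p u f :=
      expect_mono hp fun S _ ↦ hf (Finset.subset_insert e S)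
    have hg' : expect p u (fun S ↦ g (insert e S)) ≤ expect p u g :=
      expect_mono hp fun S _ ↦ hg (Finset.subset_insert e S)
    rw [expect_insert he, expect_insert he, expect_insert he]
    simp only [Function.comp_def] at h1
    have hq : 0 ≤ 1 - p := sub_nonneg.2 hp.2
    have h2 := mul_le_mul_of_nonneg_left h1 hp.1
    have h3 := mul_le_mul_of_nonneg_left h0 hq
    have h4 := mul_nonneg (mul_nonneg hp.1 hq)
      (mul_nonneg (sub_nonneg.2 hf') (sub_nonneg.2 hg'))
    linarith

end Expectation

end TriangleSparsify

namespace TriangleSparsify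

/-! ### Triple systems with small pairwise intersections -/

section TripleSystem

variable {ι τ : Type*}

open scoped Classical in
/-- A family of three-element subsets `a t`, `t ∈ 𝓣`, of the finite set `u`, such that distinct
members share at most one element and every element lies in at most `Δ` members. The edge sets of
the triangles of a graph form such a family. -/
structure IsTripleSystem (u : Finset ι) (𝓣 : Finset τ) (a : τ → Finset ι) (Δ : ℕ) : Prop where
  subset : ∀ t ∈ 𝓣, a t ⊆ u
  card_eq : ∀ t ∈ 𝓣, (a t).card = 3
  card_inter_le : ∀ s ∈ 𝓣, ∀ t ∈ 𝓣, s ≠ t → (a s ∩ a t).card ≤ 1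
  degree_le : ∀ e, (𝓣.filter (fun t ↦ e ∈ a t)).card ≤ Δ

open scoped Classical in
/-- The number of members of the family that are contained in `S`. -/
noncomputable def countIn (𝓣 : Finset τ) (a : τ → Finset ι) (S : Finset ι) : ℕ :=
  (𝓣.filter (fun t ↦ a t ⊆ S)).card

open scoped Classical in
lemma countIn_eq_sum (𝓣 : Finset τ) (a : τ → Finset ι) (S : Finset ι) :
    (countIn 𝓣 a S : ℝ) = ∑ t ∈ 𝓣, if a t ⊆ S then 1 else 0 := by
  simp [countIn]

variable {u : Finset ι} {𝓣 : Finset τ} {a : τ → Finset ι} {Δ : ℕ} {p : ℝ}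

lemma IsTripleSystem.expect_countIn (h : IsTripleSystem u 𝓣 a Δ) :
    expect p u (fun S ↦ (countIn 𝓣 a S : ℝ)) = p ^ 3 * 𝓣.card := by
  simp only [countIn_eq_sum]
  rw [expect_sum, Finset.sum_congr rfl fun t ht ↦ by
    rw [expect_subset (h.subset t ht), h.card_eq t ht]]
  simp [mul_comm]

open scoped Classical in
lemma IsTripleSystem.card_filter_inter_le (h : IsTripleSystem u 𝓣 a Δ) (B : Finset ι) :
    (𝓣.filter (fun t ↦ ¬ Disjoint (a t) B)).card ≤ B.card * Δ := by
  have hsub : 𝓣.filter (fun t ↦ ¬ Disjoint (a t) B) ⊆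
      B.biUnion fun e ↦ 𝓣.filter (fun t ↦ e ∈ a t) := by
    intro t ht
    rw [Finset.mem_filter, Finset.not_disjoint_iff] at ht
    obtain ⟨ht, e, he, heB⟩ := ht
    exact Finset.mem_biUnion.2 ⟨e, heB, Finset.mem_filter.2 ⟨ht, he⟩⟩
  exact (Finset.card_le_card hsub).trans (Finset.card_biUnion_le_card_mul _ _ _ 
    fun e _ ↦ h.degree_le e)

open scoped Classical in
/-- A member that meets `B` in two elements is determined by these, so there are at most `#B ^ 2`
such members. -/
lemma IsTripleSystem.card_filter_one_lt_le (h : IsTripleSystem u 𝓣 a Δ) (B : Finset ι) :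
    (𝓣.filter (fun t ↦ 1 < (a t ∩ B).card)).card ≤ B.card ^ 2 := by
  have hex : ∀ t, ∃ x : Option (ι × ι), 1 < (a t ∩ B).card →
      ∃ y z, x = some (y, z) ∧ y ∈ a t ∩ B ∧ z ∈ a t ∩ B ∧ y ≠ z := by
    intro t
    by_cases ht : 1 < (a t ∩ B).card
    · obtain ⟨y, hy, z, hz, hne⟩ := Finset.one_lt_card.1 ht
      exact ⟨some (y, z), fun _ ↦ ⟨y, z, rfl, hy, hz, hne⟩⟩
    · exact ⟨none, fun h ↦ absurd h ht⟩
  choose φ hφ using hex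
  have hcard : ((B ×ˢ B).map Function.Embedding.some).card = B.card ^ 2 := by
    rw [Finset.card_map, Finset.card_product, sq]
  rw [← hcard]
  refine Finset.card_le_card_of_injOn φ ?_ ?_
  · intro t ht
    obtain ⟨y, z, hx, hy, hz, -⟩ := hφ t (Finset.mem_filter.1 ht).2
    rw [hx]
    simp only [Finset.mem_inter] at hy hz
    simp [hy.2, hz.2]
  · intro s hs t ht hst
    simp only [Finset.coe_filter, Set.mem_ofPred_eq] at hs ht
    by_contra hne
    obtain ⟨y, z, hx, hy, hz, hyz⟩ := hφ s hs.2
    obtain ⟨y', z', hx', hy', hz', -⟩ := hφ t ht.2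
    rw [hst, hx'] at hx
    simp only [Option.some.injEq, Prod.mk.injEq] at hx
    obtain ⟨rfl, rfl⟩ := hx
    simp only [Finset.mem_inter] at hy hz hy' hz'
    refine absurd (h.card_inter_le s hs.1 t ht.1 hne) (not_le.2 (Finset.one_lt_card.2
      ⟨y', ?_, z', ?_, hyz⟩)) <;> simp [hy, hz, hy', hz']

open scoped Classical in
/-- The left-hand side is the conditional expectation of the number of kept members, given that
all of `B` is kept. Members disjoint from `B` contribute at most `p ^ 3 * #𝓣`, those meeting it in
one element `#B * Δ * p ^ 2`, and the others `#B ^ 2`. -/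
lemma IsTripleSystem.sum_pow_card_sdiff_le (h : IsTripleSystem u 𝓣 a Δ)
    (hp : p ∈ Set.Icc (0 : ℝ) 1) (B : Finset ι) :
    ∑ t ∈ 𝓣, p ^ (a t \ B).card ≤
      p ^ 3 * 𝓣.card + B.card * Δ * p ^ 2 + (B.card : ℝ) ^ 2 := by
  have hpt : ∀ t ∈ 𝓣, p ^ (a t \ B).card ≤ p ^ 3 +
      (if ¬ Disjoint (a t) B then p ^ 2 else 0) + (if 1 < (a t ∩ B).card then 1 else 0) := by
    intro t ht
    have hadd := Finset.card_sdiff_add_card_inter (a t) B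
    rw [h.card_eq t ht] at hadd
    have h3 : 0 ≤ p ^ 3 := pow_nonneg hp.1 _
    have h2 : 0 ≤ p ^ 2 := pow_nonneg hp.1 _
    have h1 : p ^ (a t \ B).card ≤ 1 := pow_le_one₀ hp.1 hp.2
    simp only [Finset.disjoint_iff_inter_eq_empty, ← Finset.card_eq_zero]
    rcases lt_trichotomy (a t ∩ B).card 1 with hc | hc | hc
    · have : (a t \ B).card = 3 := by omega
      rw [this]
      split_ifs <;> linarith
    · have : (a t \ B).card = 2 := by omega
      rw [this]
      simp [hc, h3]
    · split_ifs <;> linarith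
  refine (Finset.sum_le_sum hpt).trans ?_
  rw [Finset.sum_add_distrib, Finset.sum_add_distrib, Finset.sum_const, ← Finset.sum_filter,
    ← Finset.sum_filter, Finset.sum_const, Finset.sum_const]
  simp only [nsmul_eq_mul, mul_one]
  have e1 : ((𝓣.filter (fun t ↦ ¬ Disjoint (a t) B)).card : ℝ) ≤ B.card * Δ :=
    mod_cast h.card_filter_inter_le B
  have e2 : ((𝓣.filter (fun t ↦ 1 < (a t ∩ B).card)).card : ℝ) ≤ (B.card : ℝ) ^ 2 :=
    mod_cast h.card_filter_one_lt_le B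
  have := mul_le_mul_of_nonneg_right e1 (pow_nonneg hp.1 2)
  linarith

/-! ### The upper tail -/

open scoped Classical in
lemma IsTripleSystem.expect_indicator_mul_pow_le (h : IsTripleSystem u 𝓣 a Δ)
    (hp : p ∈ Set.Icc (0 : ℝ) 1) (m k : ℕ) {B : Finset ι} (hB : B ⊆ u) (hm : B.card + 3 * k ≤ m) :
    expect p u (fun S ↦ if B ⊆ S then (countIn 𝓣 a S : ℝ) ^ k else 0) ≤
      p ^ B.card * (p ^ 3 * 𝓣.card + m * Δ * p ^ 2 + (m : ℝ) ^ 2) ^ k := by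
  set R : ℝ := p ^ 3 * 𝓣.card + m * Δ * p ^ 2 + (m : ℝ) ^ 2 with hR
  have hR0 : 0 ≤ R := by have := hp.1; positivity
  induction k generalizing B with
  | zero => simp [expect_subset hB]
  | succ k ih =>
    have hexp : ∀ S : Finset ι, (if B ⊆ S then (countIn 𝓣 a S : ℝ) ^ (k + 1) else 0) =
        ∑ t ∈ 𝓣, if B ∪ a t ⊆ S then (countIn 𝓣 a S : ℝ) ^ k else 0 := by
      intro S
      by_cases hBS : B ⊆ S
      · rw [if_pos hBS, pow_succ, countIn_eq_sum, Finset.mul_sum]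
        refine Finset.sum_congr rfl fun t _ ↦ ?_
        simp [Finset.union_subset_iff, hBS]
      · rw [if_neg hBS, Finset.sum_eq_zero]
        exact fun t _ ↦ if_neg fun h' ↦ hBS (Finset.union_subset_iff.1 h').1
    simp only [hexp]
    rw [expect_sum]
    calc ∑ t ∈ 𝓣, expect p u (fun S ↦ if B ∪ a t ⊆ S then (countIn 𝓣 a S : ℝ) ^ k else 0)
        ≤ ∑ t ∈ 𝓣, p ^ B.card * R ^ k * p ^ (a t \ B).card := by
          refine Finset.sum_le_sum fun t ht ↦ ?_
          have hc : (B ∪ a t).card = B.card + (a t \ B).card := by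
            rw [← Finset.union_sdiff_self_eq_union, Finset.card_union_of_disjoint
              Finset.disjoint_sdiff]
          have hle : (a t \ B).card ≤ 3 :=
            (Finset.card_le_card Finset.sdiff_subset).trans (h.card_eq t ht).le
          refine (ih (Finset.union_subset hB (h.subset t ht)) (by omega)).trans_eq ?_
          rw [hc, pow_add]
          ring
      _ = p ^ B.card * R ^ k * ∑ t ∈ 𝓣, p ^ (a t \ B).card := by rw [Finset.mul_sum]
      _ ≤ p ^ B.card * R ^ k * R := by
          refine mul_le_mul_of_nonneg_left ((h.sum_pow_card_sdiff_le hp B).trans ?_)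
            (mul_nonneg (pow_nonneg hp.1 _) (pow_nonneg hR0 _))
          have hBm : (B.card : ℝ) ≤ m := by
            have : B.card ≤ m := by omega
            exact_mod_cast this
          rw [hR]
          gcongr
      _ = p ^ B.card * R ^ (k + 1) := by ring

/-- Each further factor of the `k`-th moment costs at most the expectation of the count conditioned
on the at most `3 * k` elements that the earlier factors force to be kept. -/
lemma IsTripleSystem.expect_countIn_pow_le (h : IsTripleSystem u 𝓣 a Δ)
    (hp : p ∈ Set.Icc (0 : ℝ) 1) (k : ℕ) :
    expect p u (fun S ↦ (countIn 𝓣 a S : ℝ) ^ k) ≤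
      (p ^ 3 * 𝓣.card + 3 * k * Δ * p ^ 2 + (3 * k : ℝ) ^ 2) ^ k := by
  have := h.expect_indicator_mul_pow_le hp (3 * k) k (Finset.empty_subset u) (by simp)
  simpa using this

open scoped Classical in
lemma IsTripleSystem.expect_upper_tail_le (h : IsTripleSystem u 𝓣 a Δ)
    (hp : p ∈ Set.Icc (0 : ℝ) 1) (k : ℕ) {x : ℝ} (hx : 0 < x) :
    expect p u (fun S ↦ if x ≤ countIn 𝓣 a S then 1 else 0) ≤
      ((p ^ 3 * 𝓣.card + 3 * k * Δ * p ^ 2 + (3 * k : ℝ) ^ 2) / x) ^ k := by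
  rw [div_pow, le_div_iff₀ (pow_pos hx k), mul_comm, ← expect_const_mul]
  refine (expect_mono hp fun S _ ↦ ?_).trans (h.expect_countIn_pow_le hp k)
  split_ifs with hS
  · rw [mul_one]
    exact pow_le_pow_left₀ hx.le hS k
  · rw [mul_zero]
    positivity

/-! ### The lower tail -/

lemma one_sub_sum_le_prod_one_sub {s : Finset τ} {f : τ → ℝ} (h0 : ∀ t ∈ s, 0 ≤ f t)
    (h1 : ∀ t ∈ s, f t ≤ 1) : 1 - ∑ t ∈ s, f t ≤ ∏ t ∈ s, (1 - f t) := by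
  classical
  induction s using Finset.induction_on with
  | empty => simp
  | insert t s ht ih =>
    simp only [Finset.forall_mem_insert] at h0 h1
    rw [Finset.sum_insert ht, Finset.prod_insert ht]
    have hs : 0 ≤ ∑ t ∈ s, f t := Finset.sum_nonneg h0.2
    have := mul_le_mul_of_nonneg_left (ih h0.2 h1.2) (sub_nonneg.2 h1.1)
    nlinarith [mul_nonneg h0.1 hs]

open scoped Classical in
/-- The function `S ↦ (1 - η) ^ T`, where `T` is the number of members of the family contained
in `S`, written as a product over the family. -/
noncomputable def discount (η : ℝ) (𝓢 : Finset τ) (a : τ → Finset ι) (S : Finset ι) : ℝ :=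
  ∏ t ∈ 𝓢, (1 - η * if a t ⊆ S then 1 else 0)

lemma discount_eq_pow (η : ℝ) (𝓢 : Finset τ) (a : τ → Finset ι) (S : Finset ι) :
    discount η 𝓢 a S = (1 - η) ^ countIn 𝓢 a S := by
  classical
  rw [countIn, ← Finset.prod_const, Finset.prod_filter, discount]
  refine Finset.prod_congr rfl fun t _ ↦ ?_
  split_ifs <;> simp

variable {η : ℝ}

lemma discount_nonneg (hη1 : η ≤ 1) (𝓢 : Finset τ) (a : τ → Finset ι) (S : Finset ι) :
    0 ≤ discount η 𝓢 a S := by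
  rw [discount_eq_pow]
  exact pow_nonneg (sub_nonneg.2 hη1) _

lemma discount_le_one (hη0 : 0 ≤ η) (hη1 : η ≤ 1) (𝓢 : Finset τ) (a : τ → Finset ι)
    (S : Finset ι) : discount η 𝓢 a S ≤ 1 := by
  rw [discount_eq_pow]
  exact pow_le_one₀ (sub_nonneg.2 hη1) (by linarith)

lemma countIn_mono (𝓢 : Finset τ) (a : τ → Finset ι) : Monotone (countIn 𝓢 a) := by
  classical
  intro S S' hS
  exact Finset.card_le_card (Finset.monotone_filter_right _ fun t _ ht ↦ ht.trans hS)

lemma discount_antitone (hη0 : 0 ≤ η) (hη1 : η ≤ 1) (𝓢 : Finset τ) (a : τ → Finset ι) :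
    Antitone (discount η 𝓢 a) := by
  intro S S' hS
  rw [discount_eq_pow, discount_eq_pow]
  exact pow_le_pow_of_le_one (sub_nonneg.2 hη1) (by linarith) (countIn_mono 𝓢 a hS)

open scoped Classical in
/-- Conditioned on the member `a t` being kept, the members of `𝓢` meeting `a t` discount the
expectation by at most `1 - η * (3 * Δ * p ^ 2)`, and by Harris' inequality the two groups of
members, meeting `a t` or not, can be treated separately. -/
lemma IsTripleSystem.le_expect_indicator_mul_discount (h : IsTripleSystem u 𝓣 a Δ)
    (hp : p ∈ Set.Icc (0 : ℝ) 1) (hη0 : 0 ≤ η) (hη1 : η ≤ 1)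
    {𝓢 : Finset τ} (h𝓢 : 𝓢 ⊆ 𝓣) {t : τ} (ht : t ∈ 𝓣) (ht' : t ∉ 𝓢) :
    p ^ 3 * ((1 - η * (3 * Δ * p ^ 2)) * expect p u (discount η 𝓢 a)) ≤
      expect p u (fun S ↦ if a t ⊆ S then discount η 𝓢 a S else 0) := by
  rw [expect_indicator_subset (h.subset t ht), h.card_eq t ht]
  refine mul_le_mul_of_nonneg_left ?_ (pow_nonneg hp.1 3)
  set 𝓓 := 𝓢.filter (fun s ↦ ¬ Disjoint (a s) (a t)) with h𝓓
  set 𝓘 := 𝓢.filter (fun s ↦ Disjoint (a s) (a t)) with h𝓘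
  have hsplit : ∀ S, discount η 𝓢 a S = discount η 𝓓 a S * discount η 𝓘 a S := fun S ↦ by
    rw [mul_comm]
    exact (Finset.prod_filter_mul_prod_filter_not 𝓢 _ _).symm
  have hmono : Monotone fun S : Finset ι ↦ S ∪ a t := fun S S' hS ↦
    Finset.union_subset_union_left hS
  have hharris := expect_mul_expect_le hp u
    ((discount_antitone hη0 hη1 𝓓 a).comp_monotone hmono)
    ((discount_antitone hη0 hη1 𝓘 a).comp_monotone hmono)
  simp only [Function.comp_def] at hharris
  rw [show discount η 𝓢 a = fun S ↦ discount η 𝓓 a S * discount η 𝓘 a S from funext hsplit]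
  refine le_trans ?_ hharris
  have hind : expect p u (fun S ↦ discount η 𝓓 a S * discount η 𝓘 a S) ≤
      expect p u (fun S ↦ discount η 𝓘 a (S ∪ a t)) := by
    refine expect_mono hp fun S _ ↦ ?_
    have heq : discount η 𝓘 a (S ∪ a t) = discount η 𝓘 a S := by
      refine Finset.prod_congr rfl fun s hs ↦ ?_
      have hd : Disjoint (a s) (a t) := (Finset.mem_filter.1 hs).2
      have hiff : a s ⊆ S ∪ a t ↔ a s ⊆ S :=
        ⟨fun hs' ↦ hd.left_le_of_le_sup_right hs', fun hs' ↦ hs'.trans Finset.subset_union_left⟩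
      simp only [hiff]
    rw [heq]
    exact mul_le_of_le_one_left (discount_nonneg hη1 _ _ _) (discount_le_one hη0 hη1 _ _ _)
  have hdep : 1 - η * (3 * Δ * p ^ 2) ≤ expect p u (fun S ↦ discount η 𝓓 a (S ∪ a t)) := by
    have hprob : ∀ s ∈ 𝓓,
        expect p u (fun S ↦ if a s ⊆ S ∪ a t then 1 else 0) = p ^ 2 := by
      intro s hs
      rw [h𝓓, Finset.mem_filter, Finset.disjoint_iff_inter_eq_empty, ← Finset.card_eq_zero] at hs
      have hst : s ≠ t := fun h' ↦ ht' (h' ▸ hs.1)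
      have hadd := Finset.card_sdiff_add_card_inter (a s) (a t)
      have hle := h.card_inter_le s (h𝓢 hs.1) t ht hst
      rw [h.card_eq s (h𝓢 hs.1)] at hadd
      have hiff : ∀ S, a s ⊆ S ∪ a t ↔ a s \ a t ⊆ S := fun S ↦ by
        rw [Finset.union_comm]
        exact sdiff_le_iff.symm
      simp only [hiff]
      rw [expect_subset (Finset.sdiff_subset.trans (h.subset s (h𝓢 hs.1)))]
      congr 1
      omega
    have hcard : (𝓓.card : ℝ) ≤ 3 * Δ := by
      have h1 : 𝓓.card ≤ (𝓣.filter (fun s ↦ ¬ Disjoint (a s) (a t))).card :=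
        Finset.card_le_card (Finset.filter_subset_filter _ h𝓢)
      have h2 := h1.trans (h.card_filter_inter_le (a t))
      rw [h.card_eq t ht] at h2
      exact_mod_cast h2
    calc 1 - η * (3 * Δ * p ^ 2) ≤ 1 - η * (𝓓.card * p ^ 2) := by
          have := mul_le_mul_of_nonneg_left
            (mul_le_mul_of_nonneg_right hcard (pow_nonneg hp.1 2)) hη0
          linarith
      _ = expect p u (fun S ↦ 1 - ∑ s ∈ 𝓓, η * if a s ⊆ S ∪ a t then 1 else 0) := by
          rw [expect_sub, expect_const, expect_sum]
          simp only [expect_const_mul]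
          rw [← Finset.mul_sum, Finset.sum_congr rfl hprob]
          simp
      _ ≤ expect p u (fun S ↦ discount η 𝓓 a (S ∪ a t)) := by
          refine expect_mono hp fun S _ ↦ one_sub_sum_le_prod_one_sub ?_ ?_
          · intro s _
            split_ifs <;> simp [hη0]
          · intro s _
            split_ifs <;> simp [hη1]
  refine mul_le_mul hdep hind (expect_nonneg hp fun S _ ↦ ?_)
    (expect_nonneg hp fun S _ ↦ discount_nonneg hη1 _ _ _)
  exact mul_nonneg (discount_nonneg hη1 _ _ _) (discount_nonneg hη1 _ _ _)

/-- The bound on the moment generating function at the root of Janson's inequality. -/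
lemma IsTripleSystem.expect_discount_le (h : IsTripleSystem u 𝓣 a Δ)
    (hp : p ∈ Set.Icc (0 : ℝ) 1) (hη0 : 0 ≤ η) (hη1 : η ≤ 1) :
    expect p u (discount η 𝓣 a) ≤
      Real.exp (-(η * (p ^ 3 * 𝓣.card) * (1 - η * (3 * Δ * p ^ 2)))) := by
  classical
  set c : ℝ := η * p ^ 3 * (1 - η * (3 * Δ * p ^ 2)) with hc
  have key : ∀ 𝓢 ⊆ 𝓣, expect p u (discount η 𝓢 a) ≤ Real.exp (-c) ^ 𝓢.card := by
    intro 𝓢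
    induction 𝓢 using Finset.induction_on with
    | empty =>
      intro _
      rw [expect_congr (g := fun _ ↦ 1) (by simp [discount]), expect_const]
      simp
    | insert t 𝓢 ht ih =>
      intro hsub
      rw [Finset.insert_subset_iff] at hsub
      have hstep : ∀ S, discount η (insert t 𝓢) a S =
          discount η 𝓢 a S - η * if a t ⊆ S then discount η 𝓢 a S else 0 := by
        intro S
        rw [discount, Finset.prod_insert ht, ← discount]
        split_ifs <;> ring
      have hX : 0 ≤ expect p u (discount η 𝓢 a) :=
        expect_nonneg hp fun S _ ↦ discount_nonneg hη1 _ _ _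
      have hlow := mul_le_mul_of_nonneg_left
        (h.le_expect_indicator_mul_discount hp hη0 hη1 hsub.2 hsub.1 ht) hη0
      calc expect p u (discount η (insert t 𝓢) a)
          = expect p u (discount η 𝓢 a) -
              η * expect p u (fun S ↦ if a t ⊆ S then discount η 𝓢 a S else 0) := by
            rw [← expect_const_mul, ← expect_sub]
            exact expect_congr fun S _ ↦ hstep S
        _ ≤ (-c + 1) * expect p u (discount η 𝓢 a) := by
            rw [hc]; linarith
        _ ≤ Real.exp (-c) * Real.exp (-c) ^ 𝓢.card :=
            mul_le_mul (Real.add_one_le_exp _) (ih hsub.2) hX (Real.exp_pos _).le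
        _ = Real.exp (-c) ^ (insert t 𝓢).card := by
            rw [Finset.card_insert_of_notMem ht, pow_succ, mul_comm]
  refine (key 𝓣 subset_rfl).trans_eq ?_
  rw [← Real.exp_nat_mul, hc]
  congr 1
  ring

lemma exp_neg_add_sq_le_one_sub {x : ℝ} (h0 : 0 ≤ x) (h1 : x ≤ 1 / 2) :
    Real.exp (-(x + x ^ 2)) ≤ 1 - x := by
  rw [Real.exp_neg]
  refine inv_le_of_inv_le₀ (by linarith) ?_
  refine le_trans ?_ (Real.quadratic_le_exp_of_nonneg (by positivity))
  rw [inv_le_iff_one_le_mul₀' (by linarith)]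
  nlinarith [mul_nonneg (sq_nonneg x) (sub_nonneg.2 h1),
    mul_nonneg (mul_nonneg (sq_nonneg x) h0) (sub_nonneg.2 h1),
    mul_nonneg (mul_nonneg (sq_nonneg x) (sq_nonneg x)) (sub_nonneg.2 h1)]

open scoped Classical in
/-- Janson's inequality for the lower tail, up to the constant in the exponent. -/
lemma IsTripleSystem.expect_lower_tail_le (h : IsTripleSystem u 𝓣 a Δ)
    (hp : p ∈ Set.Icc (0 : ℝ) 1) {ε : ℝ} (hε0 : 0 ≤ ε) (hε1 : ε ≤ 1) :
    expect p u (fun S ↦ if (countIn 𝓣 a S : ℝ) ≤ (1 - ε) * (p ^ 3 * 𝓣.card) then 1 else 0) ≤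
      Real.exp (-(ε ^ 2 * (p ^ 3 * 𝓣.card) / (4 * (1 + 3 * Δ * p ^ 2)))) := by
  set m : ℝ := p ^ 3 * 𝓣.card with hm
  set D : ℝ := 3 * Δ * p ^ 2 with hD
  have hm0 : 0 ≤ m := by have := hp.1; positivity
  have hD0 : 0 ≤ D := by positivity
  -- the value of `η` minimizing the exponent `η * m * (-ε + η * (1 + D))`
  set η : ℝ := ε / (2 * (1 + D)) with hη
  have hηε : η * (1 + D) = ε / 2 := by rw [hη]; field_simp
  have hη0 : 0 ≤ η := by positivity
  have hηD0 : 0 ≤ η * D := mul_nonneg hη0 hD0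
  have hη2 : η ≤ 1 / 2 := by linarith
  have hpt : ∀ S : Finset ι, (if (countIn 𝓣 a S : ℝ) ≤ (1 - ε) * m then (1 : ℝ) else 0) ≤
      Real.exp ((η + η ^ 2) * ((1 - ε) * m)) * discount η 𝓣 a S := by
    intro S
    split_ifs with hS
    · have h1 : Real.exp (-(η + η ^ 2)) ^ countIn 𝓣 a S ≤ discount η 𝓣 a S := by
        rw [discount_eq_pow]
        exact pow_le_pow_left₀ (Real.exp_pos _).le (exp_neg_add_sq_le_one_sub hη0 hη2) _
      rw [← Real.exp_nat_mul] at h1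
      refine le_trans ?_ (mul_le_mul_of_nonneg_left h1 (Real.exp_pos _).le)
      rw [← Real.exp_add, Real.one_le_exp_iff]
      have := mul_le_mul_of_nonneg_left hS (by positivity : 0 ≤ η + η ^ 2)
      linarith
    · exact mul_nonneg (Real.exp_pos _).le (discount_nonneg (by linarith) _ _ _)
  calc expect p u (fun S ↦ if (countIn 𝓣 a S : ℝ) ≤ (1 - ε) * m then 1 else 0)
      ≤ Real.exp ((η + η ^ 2) * ((1 - ε) * m)) * expect p u (discount η 𝓣 a) := by
        rw [← expect_const_mul]
        exact expect_mono hp fun S _ ↦ hpt S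
    _ ≤ Real.exp ((η + η ^ 2) * ((1 - ε) * m)) * Real.exp (-(η * m * (1 - η * D))) :=
        mul_le_mul_of_nonneg_left
          (h.expect_discount_le hp hη0 (by linarith)) (Real.exp_pos _).le
    _ ≤ Real.exp (-(ε ^ 2 * m / (4 * (1 + D)))) := by
        rw [← Real.exp_add, Real.exp_le_exp]
        have e1 : ε ^ 2 * m / (4 * (1 + D)) = η * m * (ε / 2) := by
          rw [hη]; field_simp; ring
        rw [e1]
        have e2 := mul_nonneg hη0 hm0
        have e3 : 0 ≤ η * m * (η * ε) := mul_nonneg e2 (mul_nonneg hη0 hε0)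
        have e4 : η * m * (η * (1 + D)) = η * m * (ε / 2) := by rw [hηε]
        linarith

end TripleSystem

end TriangleSparsify

namespace TriangleSparsify

/-! ### Two-sided concentration -/

section Concentration

variable {ι τ : Type*} {u : Finset ι} {𝓣 : Finset τ} {a : τ → Finset ι} {Δ : ℕ} {p : ℝ}

open scoped Classical in
/-- The quantity `L` plays the role of `log n`. The upper tail is estimated by a moment of order
`⌈C * L⌉₊`. -/
lemma IsTripleSystem.expect_deviation_le (h : IsTripleSystem u 𝓣 a Δ)
    (hp : p ∈ Set.Icc (0 : ℝ) 1) {K ε C L M : ℝ} (hε : 0 < ε) (hC : 0 ≤ C)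
    (hCK : K + 1 ≤ C * Real.log ((1 + ε) / (1 + ε / 2))) (hL : 1 ≤ L)
    (hLC : 24 * (C + 1) ^ 2 ≤ ε * L) (hLK : 16 * (K + 1) ≤ (min ε 1) ^ 2 * L)
    (hM : 1 ≤ M) (hΔM : p ^ 2 * Δ ≤ M) (hμ : L ^ 6 * M ≤ p ^ 3 * 𝓣.card) :
    expect p u (fun S ↦
      if ε * (p ^ 3 * 𝓣.card) ≤ |(countIn 𝓣 a S : ℝ) - p ^ 3 * 𝓣.card| then 1 else 0) ≤
      Real.exp (-(K * L)) := by
  set m : ℝ := p ^ 3 * 𝓣.card with hm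
  have hL0 : 0 < L := by linarith
  have hM0 : 0 < M := by linarith
  have hm0 : 0 < m := lt_of_lt_of_le (by positivity) hμ
  have hupper : expect p u (fun S ↦ if (1 + ε) * m ≤ countIn 𝓣 a S then 1 else 0) ≤
      Real.exp (-((K + 1) * L)) := by
    set k := ⌈C * L⌉₊ with hk
    have hk1 : C * L ≤ k := Nat.le_ceil _
    have hk2 : (k : ℝ) ≤ (C + 1) * L := by
      have := (Nat.ceil_lt_add_one (by positivity : 0 ≤ C * L)).le
      linarith
    have hkk : (k : ℝ) ≤ (k : ℝ) ^ 2 := by exact_mod_cast Nat.le_self_pow two_ne_zero k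
    have hrem : 3 * k * Δ * p ^ 2 + (3 * k : ℝ) ^ 2 ≤ ε / 2 * m := by
      have e1 : 3 * k * Δ * p ^ 2 ≤ 3 * (k : ℝ) ^ 2 * M := by
        have : (k : ℝ) * (p ^ 2 * Δ) ≤ (k : ℝ) ^ 2 * M := by gcongr
        linarith
      have e2 : (k : ℝ) ^ 2 * 1 ≤ (k : ℝ) ^ 2 * M := by gcongr
      have e3 : (k : ℝ) ^ 2 * M ≤ ((C + 1) * L) ^ 2 * M := by gcongr
      have e4 : 24 * (C + 1) ^ 2 * (L ^ 2 * M) ≤ ε * L * (L ^ 2 * M) := by gcongr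
      have e5 : ε * (L ^ 3 * M) ≤ ε * (L ^ 6 * M) := by
        exact mul_le_mul_of_nonneg_left (mul_le_mul_of_nonneg_right
          (pow_le_pow_right₀ hL (by norm_num)) hM0.le) hε.le
      have e6 : ε * (L ^ 6 * M) ≤ ε * m := by gcongr
      linarith
    set r := (1 + ε) / (1 + ε / 2) with hr
    have hr0 : 0 < r := by positivity
    have hlog : 0 ≤ Real.log r := by
      refine Real.log_nonneg ?_
      rw [hr, le_div_iff₀ (by positivity)]
      linarith
    refine (h.expect_upper_tail_le hp k (by positivity : 0 < (1 + ε) * m)).trans ?_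
    calc ((m + 3 * k * Δ * p ^ 2 + (3 * k : ℝ) ^ 2) / ((1 + ε) * m)) ^ k ≤ (r⁻¹) ^ k := by
          have hp0 := hp.1
          refine pow_le_pow_left₀ (by positivity) ?_ k
          rw [div_le_iff₀ (by positivity)]
          have : r⁻¹ * ((1 + ε) * m) = (1 + ε / 2) * m := by rw [hr]; field_simp
          rw [this]
          linarith
      _ = Real.exp (-(k * Real.log r)) := by
          rw [← mul_neg, Real.exp_nat_mul, Real.exp_neg, Real.exp_log hr0]
      _ ≤ Real.exp (-((K + 1) * L)) := by
          rw [Real.exp_le_exp, neg_le_neg_iff]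
          have e1 := mul_le_mul_of_nonneg_right hCK hL0.le
          have e2 := mul_le_mul_of_nonneg_right hk1 hlog
          linarith
  have hlower : expect p u (fun S ↦ if (countIn 𝓣 a S : ℝ) ≤ (1 - ε) * m then 1 else 0) ≤
      Real.exp (-((K + 1) * L)) := by
    set δ := min ε 1 with hδ
    have hδ0 : 0 < δ := lt_min hε one_pos
    have hmono : expect p u (fun S ↦ if (countIn 𝓣 a S : ℝ) ≤ (1 - ε) * m then 1 else 0) ≤
        expect p u (fun S ↦ if (countIn 𝓣 a S : ℝ) ≤ (1 - δ) * m then 1 else 0) := by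
      refine expect_mono hp fun S _ ↦ ?_
      have : (1 - ε) * m ≤ (1 - δ) * m :=
        mul_le_mul_of_nonneg_right (by linarith [min_le_left ε 1]) hm0.le
      split_ifs with h1 h2
      · exact le_rfl
      · exact absurd (h1.trans this) h2
      · exact zero_le_one
      · exact le_rfl
    refine hmono.trans ((h.expect_lower_tail_le hp hδ0.le (min_le_right _ _)).trans ?_)
    rw [Real.exp_le_exp, neg_le_neg_iff, le_div_iff₀ (by positivity)]
    have e1 : 4 * (1 + 3 * Δ * p ^ 2) ≤ 16 * M := by linarith
    have e2 : 1 ≤ L ^ 4 := one_le_pow₀ hL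
    rcases le_or_gt (K + 1) 0 with hK | hK
    · exact (mul_nonpos_of_nonpos_of_nonneg
        (mul_nonpos_of_nonpos_of_nonneg hK hL0.le) (by positivity)).trans (by positivity)
    calc (K + 1) * L * (4 * (1 + 3 * Δ * p ^ 2)) ≤ (K + 1) * L * (16 * M) := by gcongr
      _ = 16 * (K + 1) * (L * M) * 1 := by ring
      _ ≤ (δ ^ 2 * L) * (L * M) * L ^ 4 := by gcongr
      _ = δ ^ 2 * (L ^ 6 * M) := by ring
      _ ≤ δ ^ 2 * m := by gcongr
  have hunion : expect p u (fun S ↦ if ε * m ≤ |(countIn 𝓣 a S : ℝ) - m| then 1 else 0) ≤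
      expect p u (fun S ↦ (if (1 + ε) * m ≤ countIn 𝓣 a S then 1 else 0) +
        (if (countIn 𝓣 a S : ℝ) ≤ (1 - ε) * m then 1 else 0)) := by
    refine expect_mono hp fun S _ ↦ ?_
    by_cases h1 : (1 + ε) * m ≤ countIn 𝓣 a S
    · rw [if_pos h1]
      split_ifs <;> norm_num
    by_cases h2 : (countIn 𝓣 a S : ℝ) ≤ (1 - ε) * m
    · rw [if_pos h2]
      split_ifs <;> norm_num
    rw [if_neg h1, if_neg h2, if_neg]
    · norm_num
    · rw [not_le, abs_lt]
      constructor <;> linarith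
  rw [expect_add] at hunion
  have hsum : Real.exp (-((K + 1) * L)) + Real.exp (-((K + 1) * L)) ≤ Real.exp (-(K * L)) := by
    have e1 : Real.exp (-(K * L)) = Real.exp L * Real.exp (-((K + 1) * L)) := by
      rw [← Real.exp_add]; congr 1; ring
    have e2 : 2 ≤ Real.exp L := by linarith [Real.add_one_le_exp L]
    rw [e1, ← two_mul]
    exact mul_le_mul_of_nonneg_right e2 (Real.exp_pos _).le
  linarith

end Concentration

/-! ### The sparsified graph -/

section Graph

variable {V : Type*}

open scoped Classical in
/-- The three edges of a triangle, for a set of three vertices; in general, all pairs of distinct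
elements of the set. -/
noncomputable def pairs (s : Finset V) : Finset (Sym2 V) :=
  s.offDiag.image Sym2.mk.uncurry

lemma mk_mem_pairs {s : Finset V} {x y : V} : s(x, y) ∈ pairs s ↔ x ∈ s ∧ y ∈ s ∧ x ≠ y := by
  classical
  simp only [pairs, Finset.mem_image, Finset.mem_offDiag, Prod.exists, Function.uncurry_apply_pair]
  constructor
  · rintro ⟨b, c, ⟨hb, hc, hne⟩, he⟩
    rcases Sym2.eq_iff.1 he with ⟨rfl, rfl⟩ | ⟨rfl, rfl⟩
    · exact ⟨hb, hc, hne⟩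
    · exact ⟨hc, hb, hne.symm⟩
  · exact fun h ↦ ⟨x, y, h, rfl⟩

lemma card_pairs (s : Finset V) : (pairs s).card = s.card.choose 2 := by
  classical
  exact Sym2.card_image_offDiag s

lemma pairs_inter_pairs [DecidableEq V] [DecidableEq (Sym2 V)] (s t : Finset V) : pairs s ∩ pairs t = pairs (s ∩ t) := by
  ext e
  induction e with | _ x y
  simp only [Finset.mem_inter, mk_mem_pairs]
  tauto

variable [Fintype V]

instance : MeasurableSingletonClass (SimpleGraph V) where
  measurableSet_singleton H := by
    have : ({H} : Set (SimpleGraph V)) = SimpleGraph.edgeSet ⁻¹' {H.edgeSet} := by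
      ext H'; simp
    rw [this]
    exact SimpleGraph.measurable_edgeSet (measurableSet_singleton _)

open scoped Classical in
lemma integral_setBernoulli {ι : Type*} [Finite ι] (u : Finset ι) (p : unitInterval)
    (f : Set ι → ℝ) :
    ∫ S, f S ∂(setBernoulli (u : Set ι) p) = expect p u (fun S ↦ f S) := by
  have := Fintype.ofFinite ι
  rw [integral_fintype .of_finite, ← Fintype.finsetEquivSet.sum_comp,
    ← Finset.sum_subset (Finset.subset_univ u.powerset), expect]
  · refine Finset.sum_congr rfl fun S hS ↦ ?_
    rw [Fintype.finsetEquivSet_apply,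
      setBernoulli_real_singleton p (Finset.coe_subset.2 (Finset.mem_powerset.1 hS))
        u.finite_toSet, ← Finset.coe_sdiff, Set.ncard_coe_finset, Set.ncard_coe_finset,
      smul_eq_mul]
  · intro S _ hS
    rw [Fintype.finsetEquivSet_apply, measureReal_def, setBernoulli_singleton_of_not_subset]
    · simp
    · rwa [Finset.coe_subset, ← Finset.mem_powerset]

open scoped Classical in
lemma integral_sparsify (G : SimpleGraph V) (p : unitInterval) (F : SimpleGraph V → ℝ) :
    ∫ H, F H ∂(sparsify G p) =
      expect p G.edgeFinset (fun S ↦ F (SimpleGraph.fromEdgeSet (S : Set (Sym2 V)))) := by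
  rw [sparsify, integral_map SimpleGraph.measurable_fromEdgeSet.aemeasurable
    (Measurable.of_discrete (f := F)).aestronglyMeasurable, ← G.coe_edgeFinset,
    integral_setBernoulli]

open scoped Classical in
lemma isTripleSystem_pairs (G : SimpleGraph V) :
    IsTripleSystem G.edgeFinset (G.cliqueFinset 3) pairs (maxEdgeTriangleCount G) where
  subset t ht e he := by
    induction e with | _ x y
    rw [mk_mem_pairs] at he
    rw [SimpleGraph.mem_edgeFinset, SimpleGraph.mem_edgeSet]
    exact (SimpleGraph.mem_cliqueFinset_iff.1 ht).isClique he.1 he.2.1 he.2.2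
  card_eq t ht := by
    rw [card_pairs, (SimpleGraph.mem_cliqueFinset_iff.1 ht).card_eq]
    rfl
  card_inter_le s hs t ht hst := by
    have hs3 := (SimpleGraph.mem_cliqueFinset_iff.1 hs).card_eq
    have ht3 := (SimpleGraph.mem_cliqueFinset_iff.1 ht).card_eq
    have hlt : (s ∩ t).card < 3 := by
      refine lt_of_le_of_ne ((Finset.card_le_card Finset.inter_subset_left).trans hs3.le) ?_
      intro heq
      have h1 := Finset.eq_of_subset_of_card_le (Finset.inter_subset_left (s₁ := s) (s₂ := t))
        (by omega)
      have h2 := Finset.eq_of_subset_of_card_le (Finset.inter_subset_right (s₁ := s) (s₂ := t))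
        (by omega)
      exact hst (h1.symm.trans h2)
    have hle := (Nat.choose_le_choose 2 (Nat.le_of_lt_succ hlt)).trans_eq (Nat.choose_self 2)
    rw [← card_pairs, ← pairs_inter_pairs] at hle
    convert hle
  degree_le e := by
    by_cases he : e ∈ G.edgeFinset
    · refine le_trans (Finset.card_le_card ?_) (Finset.le_sup (f := edgeTriangleCount G) he)
      intro t ht
      simp only [Finset.mem_filter] at ht
      obtain ⟨ht3, het⟩ := ht
      refine Finset.mem_filter.2 ⟨ht3, fun v hv ↦ ?_⟩
      induction e with | _ x y
      rw [mk_mem_pairs] at het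
      rcases Sym2.mem_iff.1 hv with rfl | rfl
      · exact het.1
      · exact het.2.1
    · rw [Finset.card_eq_zero.2]
      · exact Nat.zero_le _
      · refine Finset.eq_empty_of_forall_notMem fun t ht' ↦ he ?_
        simp only [Finset.mem_filter] at ht'
        obtain ⟨ht, het⟩ := ht'
        induction e with | _ x y
        rw [mk_mem_pairs] at het
        rw [SimpleGraph.mem_edgeFinset, SimpleGraph.mem_edgeSet]
        exact (SimpleGraph.mem_cliqueFinset_iff.1 ht).isClique het.1 het.2.1 het.2.2

open scoped Classical in
/-- The triangles that survive are those all of whose edges are kept. -/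
lemma triangleCount_fromEdgeSet {G : SimpleGraph V} {S : Finset (Sym2 V)}
    (hS : S ⊆ G.edgeFinset) :
    triangleCount (SimpleGraph.fromEdgeSet (S : Set (Sym2 V))) =
      countIn (G.cliqueFinset 3) pairs S := by
  unfold triangleCount countIn
  congr 1
  ext t
  simp only [Finset.mem_filter, SimpleGraph.mem_cliqueFinset_iff, SimpleGraph.isNClique_iff]
  constructor
  · rintro ⟨h, hc⟩
    refine ⟨⟨fun x hx y hy hxy ↦ ?_, hc⟩, fun e he ↦ ?_⟩
    · have := h hx hy hxy
      rw [SimpleGraph.fromEdgeSet_adj] at this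
      exact SimpleGraph.mem_edgeFinset.1 (hS this.1)
    · induction e with | _ x y
      rw [mk_mem_pairs] at he
      have := h he.1 he.2.1 he.2.2
      rw [SimpleGraph.fromEdgeSet_adj] at this
      exact this.1
  · rintro ⟨⟨-, hc⟩, h⟩
    refine ⟨fun x hx y hy hxy ↦ ?_, hc⟩
    rw [SimpleGraph.fromEdgeSet_adj]
    exact ⟨h (mk_mem_pairs.2 ⟨hx, hy, hxy⟩), hxy⟩

lemma meanTriangleCount_eq (G : SimpleGraph V) (p : unitInterval) :
    meanTriangleCount G p = (p : ℝ) ^ 3 * triangleCount G := by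
  classical
  rw [meanTriangleCount, integral_sparsify, expect_congr fun S hS ↦ by
    rw [triangleCount_fromEdgeSet hS], (isTripleSystem_pairs G).expect_countIn, triangleCount]

open scoped Classical in
lemma sparsify_real_eq (G : SimpleGraph V) (p : unitInterval) (P : ℕ → Prop) :
    (sparsify G p).real {H | P (triangleCount H)} = expect p G.edgeFinset
      (fun S ↦ if P (countIn (G.cliqueFinset 3) pairs S) then 1 else 0) := by
  rw [← integral_indicator_one (Set.toFinite _).measurableSet, integral_sparsify]
  refine expect_congr fun S hS ↦ ?_
  rw [← triangleCount_fromEdgeSet hS]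
  rfl

end Graph

end TriangleSparsify

theorem theorem2 (γ K ε : ℝ) (hγ : 0 < γ) (hK : 0 < K) (hε : 0 < ε) :
    ∃ N : ℕ, ∀ n : ℕ, N ≤ n →
      ∀ (V : Type*) [Fintype V], Fintype.card V = n →
      ∀ (G : SimpleGraph V) (p : unitInterval),
        (1 ≤ (p : ℝ) ^ 2 * (TriangleSparsify.maxEdgeTriangleCount G : ℝ) →
          Real.log n ^ (6 + γ) ≤
            (p : ℝ) * (TriangleSparsify.triangleCount G : ℝ) /
              (TriangleSparsify.maxEdgeTriangleCount G : ℝ)) →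
        ((p : ℝ) ^ 2 * (TriangleSparsify.maxEdgeTriangleCount G : ℝ) < 1 →
          Real.log n ^ (6 + γ) ≤
            (p : ℝ) ^ 3 * (TriangleSparsify.triangleCount G : ℝ)) →
        TriangleSparsify.meanTriangleCount G p =
            (p : ℝ) ^ 3 * (TriangleSparsify.triangleCount G : ℝ) ∧
          (TriangleSparsify.sparsify G p).real
            {H | ε * TriangleSparsify.meanTriangleCount G p ≤
              |(TriangleSparsify.triangleCount H : ℝ) -
                TriangleSparsify.meanTriangleCount G p|} ≤ (n : ℝ) ^ (-K) := by
  classical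
  set r := Real.log ((1 + ε) / (1 + ε / 2)) with hr
  have hr0 : 0 < r := by
    refine Real.log_pos ?_
    rw [lt_div_iff₀ (by positivity)]
    linarith
  set C := (K + 1) / r with hC
  have hC0 : 0 ≤ C := by positivity
  have hδ0 : 0 < min ε 1 := lt_min hε one_pos
  obtain ⟨N, hN⟩ := Filter.eventually_atTop.1
    ((Real.tendsto_log_atTop.comp tendsto_natCast_atTop_atTop).eventually_ge_atTop
      (max 1 (max (24 * (C + 1) ^ 2 / ε) (16 * (K + 1) / (min ε 1) ^ 2))))
  refine ⟨max N 1, fun n hn V _ _ G p h1 h2 ↦ ⟨TriangleSparsify.meanTriangleCount_eq G p, ?_⟩⟩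
  have hn0 : (0 : ℝ) < n := by
    have : 0 < n := (le_max_right N 1).trans hn
    exact_mod_cast this
  have hLn := hN n ((le_max_left N 1).trans hn)
  simp only [Function.comp_apply, max_le_iff] at hLn
  obtain ⟨hL, hLC, hLK⟩ := hLn
  rw [div_le_iff₀' (by positivity)] at hLC hLK
  have hp := p.2
  set Δ := TriangleSparsify.maxEdgeTriangleCount G
  have hpow : Real.log n ^ 6 ≤ Real.log n ^ (6 + γ) := by
    rw [← Real.rpow_natCast]
    refine Real.rpow_le_rpow_of_exponent_le hL ?_
    push_cast
    linarith
  -- the two hypotheses combine to `log n ^ 6 * max 1 (p ^ 2 * Δ) ≤ p ^ 3 * t`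
  have hμ : Real.log n ^ 6 * max 1 ((p : ℝ) ^ 2 * Δ) ≤
      (p : ℝ) ^ 3 * (TriangleSparsify.triangleCount G : ℝ) := by
    rcases le_or_gt 1 ((p : ℝ) ^ 2 * Δ) with hc | hc
    · rw [max_eq_right hc]
      have hΔ : (Δ : ℝ) ≠ 0 := by
        intro h0
        rw [h0, mul_zero] at hc
        linarith
      calc Real.log n ^ 6 * ((p : ℝ) ^ 2 * Δ)
          ≤ (p : ℝ) * (TriangleSparsify.triangleCount G : ℝ) / Δ * ((p : ℝ) ^ 2 * Δ) :=
            mul_le_mul_of_nonneg_right (hpow.trans (h1 hc)) (by linarith)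
        _ = (p : ℝ) ^ 3 * (TriangleSparsify.triangleCount G : ℝ) := by
            field_simp
    · rw [max_eq_left hc.le, mul_one]
      exact hpow.trans (h2 hc)
  rw [TriangleSparsify.meanTriangleCount_eq, TriangleSparsify.sparsify_real_eq G p
    fun T ↦ ε * ((p : ℝ) ^ 3 * TriangleSparsify.triangleCount G) ≤
      |(T : ℝ) - (p : ℝ) ^ 3 * TriangleSparsify.triangleCount G|,
    Real.rpow_def_of_pos hn0, mul_neg, mul_comm (Real.log n)]
  exact (TriangleSparsify.isTripleSystem_pairs G).expect_deviation_le hp hε hC0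
    (div_mul_cancel₀ _ hr0.ne').ge hL hLC hLK (le_max_left _ _) (le_max_right _ _) hμ
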